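/- Let $\mathbb F$ be a field and $l\in\mathbb N$. A p.f.d. persistence module is a functor $V$ from the totally ordered set $\{0,1,\dots,l\}$ to finite-dimensional $\mathbb F$-vector spaces, with inner morphisms $v_{s,t}\colon V_s\to V_t$ for $s\le t$; morphisms are natural transformations. For an integer $k\ge 0$ the shift $V(k)$ is given by $V(k)_t=V_{t+k}$ and $v(k)_{s,t}=v_{s+k,t+k}$, where $V$ is extended by $0$ beyond $l$. For $0\le i\le j\le l$ the interval module $k_{[i,j]}$ is $\mathbb F$ at the indices in $[i,j]$ and $0$ at all others, with identity maps between indices in $[i,j]$; the bars of $V$ are the intervals $J$ for which $k_J$ appears in the decomposition of $V$ into interval modules. The nestedness of $V$ is $$\Xi(V)=\min\bigl\{\min(|a-c|,|b-d|)\;:\;[a,b],[c,d]\text{ bars of }V,\ c<a\le b<d\bigr\},$$ with $\Xi(V)=\infty$ if there are no such (strictly nested) pairs. For $\delta\ge 0$ with $2\delta\in\mathbb Z$, a morphism $\Phi\colon V\to W$ is $\delta$-invertible if there is a morphism $\Psi\colon W\to V(2\delta)$ such that $\Psi_t\circ\Phi_t=v_{t,t+2\delta}$ and $\Phi_{t+2\delta}\circ\Psi_t=w_{t,t+2\delta}$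 for all $t$. Write $[i_1,j_1]\preceq[i_2,j_2]$ if $i_1\le i_2\le j_1\le j_2$. A morphism $\Phi\colon V\to W$ is viewed as a ladder module $(V,W,\Phi)$, isomorphisms of ladder modules being pairs of isomorphisms on source and target that form a commutative square. The elementary ladder modules are $\mathbf R_{J_1}^{J_2}=(k_{J_2}\to k_{J_1})$ for $J_1\preceq J_2$, where the map is the identity of $\mathbb F$ at the indices in $J_1\cap J_2$ and $0$ elsewhere, $\mathbf I^+_J=(k_J\to 0)$ and $\mathbf I^-_K=(0\to k_K)$. **Theorem.** Let $V$ and $W$ be p.f.d. persistence modules over $\mathbb F$ indexed by $\{0,1,\dots,l\}$, and let $\Phi\colon V\to W$ be a $\delta$-invertible morphism with $\delta<\frac12\min(\Xi(V),\Xi(W))$. Then there exist $r_{J_1}^{J_2},d_J^+,d_K^-\in\mathbb N$ such that $$(V,W,\Phi)\cong\bigoplus_{J_1\preceq J_2}\bigl(\mathbf R_{J_1}^{J_2}\bigr)^{r_{J_1}^{J_2}}\oplus\bigoplus_J\bigl(\mathbf I^+_J\bigr)^{d_J^+}\oplus\bigoplus_K\bigl(\mathbf I^-_K\bigr)^{d_K^-}.$$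 -/

import Mathlib

open CategoryTheory CategoryTheory.Limits
open scoped ENNReal NNReal ZeroObject

universe u

namespace Persistence

/-! ### Intervals of `{0, 1, …, l}` -/

/-- Nonempty closed intervals `[i, j]`, `i ≤ j`, of the index set `{0, 1, …, l}`. -/
abbrev Bar (l : ℕ) : Type := NonemptyInterval (Fin (l + 1))

instance (l : ℕ) : Finite (Bar l) :=
  Finite.of_injective (fun J : Bar l => J.toProd) NonemptyInterval.toProd_injective

/-- The overlapping relation: `[i₁, j₁] ⪯ [i₂, j₂]` iff `i₁ ≤ i₂ ≤ j₁ ≤ j₂`. -/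
def Overlaps {l : ℕ} (J₁ J₂ : Bar l) : Prop :=
  J₁.fst ≤ J₂.fst ∧ J₂.fst ≤ J₁.snd ∧ J₁.snd ≤ J₂.snd

/-- `[i₁, j₁]` is strictly nested in `[i₂, j₂]` iff `i₂ < i₁ ≤ j₁ < j₂`. -/
def StrictlyNested {l : ℕ} (J₁ J₂ : Bar l) : Prop :=
  J₂.fst < J₁.fst ∧ J₁.fst ≤ J₁.snd ∧ J₁.snd < J₂.snd

/-! ### Persistence modules -/

/-- Persistence modules over the field `F` indexed by `{0, 1, …, l}`: functors to `F`-vector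
spaces. A morphism of persistence modules is a natural transformation. -/
abbrev PMod (F : Type u) [Field F] (l : ℕ) : Type (u + 1) := Fin (l + 1) ⥤ ModuleCat.{u} F

instance (F : Type u) [Field F] (l : ℕ) : HasFiniteBiproducts (PMod F l) :=
  Abelian.hasFiniteBiproducts

/-- Pointwise finite dimensional persistence modules. -/
def IsPFD {F : Type u} [Field F] {l : ℕ} (V : PMod F l) : Prop :=
  ∀ i, FiniteDimensional F (V.obj i)

/-- For a proposition `p`, the function space `PLift p → F` is a copy of `F` if `p` holds and is
zero otherwise. This is the linear map between two such spaces that is the identity of `F` if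
both propositions hold, and zero otherwise. -/
noncomputable def transfer (F : Type u) [Field F] (p q : Prop) :
    (PLift p → F) →ₗ[F] (PLift q → F) := by
  classical
  exact
    { toFun := fun x _ => if hp : p then x ⟨hp⟩ else 0
      map_add' := by intro x y; ext h; by_cases hp : p <;> simp [hp]
      map_smul' := by intro c x; ext h; by_cases hp : p <;> simp [hp] }

theorem transfer_self (F : Type u) [Field F] (p : Prop) :
    transfer F p p = LinearMap.id := by
  refine LinearMap.ext fun x => funext fun h => ?_
  simp [transfer, h.down]

theorem transfer_comp (F : Type u) [Field F] {p q r : Prop} (hpqr : p → r → q) :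
    (transfer F q r).comp (transfer F p q) = transfer F p r := by
  refine LinearMap.ext fun x => funext fun h => ?_
  by_cases hp : p
  · simp [transfer, hp, hpqr hp h.down]
  · simp [transfer, hp]

/-- The interval persistence module `k_J`: it is `F` at the indices in `J` and `0` at all others,
with identity inner morphisms between indices in `J`. -/
noncomputable def intervalModule (F : Type u) [Field F] {l : ℕ} (J : Bar l) : PMod F l where
  obj t := ModuleCat.of F (PLift (t ∈ J) → F)
  map {s t} _ := ModuleCat.ofHom (transfer F (s ∈ J) (t ∈ J))
  map_id t := by rw [transfer_self]; rfl
  map_comp {r s t} f g := by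
    rw [← ModuleCat.ofHom_comp, transfer_comp]
    exact fun hr ht => ⟨hr.1.trans (leOfHom f), (leOfHom g).trans ht.2⟩

/-- The shift `V(k)`, with `V(k)_t = V_{t+k}`, where `V` is zero beyond its index set: the space
at `t` is a copy of `V_{t+k}` if `t + k ≤ l`, and zero otherwise. -/
noncomputable def shift {F : Type u} [Field F] {l : ℕ} (k : ℕ) (V : PMod F l) : PMod F l where
  obj t := ModuleCat.of F
    (∀ h : PLift (t.val + k ≤ l), V.obj ⟨t.val + k, Nat.lt_succ_of_le h.down⟩)
  map {s t} f := ModuleCat.ofHom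
    { toFun := fun x h =>
        (V.map (homOfLE (Nat.add_le_add_right (leOfHom f) k) :
          (⟨s.val + k, Nat.lt_succ_of_le
              ((Nat.add_le_add_right (leOfHom f) k).trans h.down)⟩ : Fin (l + 1)) ⟶
            ⟨t.val + k, Nat.lt_succ_of_le h.down⟩)).hom
          (x ⟨(Nat.add_le_add_right (leOfHom f) k).trans h.down⟩)
      map_add' := by intro x y; ext h; simp
      map_smul' := by intro c x; ext h; simp }
  map_id t := by
    refine ModuleCat.hom_ext (LinearMap.ext fun x => funext fun h => ?_)
    exact congrArg (fun φ => φ.hom (x h)) (V.map_id _)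
  map_comp {r s t} f g := by
    refine ModuleCat.hom_ext (LinearMap.ext fun x => funext fun h => ?_)
    exact congrArg (fun φ => φ.hom (x ⟨(Nat.add_le_add_right (leOfHom (f ≫ g)) k).trans h.down⟩))
      (V.map_comp
        (homOfLE (Nat.add_le_add_right (leOfHom f) k) :
          (⟨r.val + k, Nat.lt_succ_of_le
              ((Nat.add_le_add_right (leOfHom (f ≫ g)) k).trans h.down)⟩ : Fin (l + 1)) ⟶
            ⟨s.val + k, Nat.lt_succ_of_le
              ((Nat.add_le_add_right (leOfHom g) k).trans h.down)⟩)
        (homOfLE (Nat.add_le_add_right (leOfHom g) k) :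
          _ ⟶ (⟨t.val + k, Nat.lt_succ_of_le h.down⟩ : Fin (l + 1))))

/-- The shift `Φ(k) : V(k) ⟶ W(k)` of a morphism, with components `Φ_{t+k}`. -/
noncomputable def shiftMap {F : Type u} [Field F] {l : ℕ} (k : ℕ) {V W : PMod F l}
    (Φ : V ⟶ W) : shift k V ⟶ shift k W where
  app t := ModuleCat.ofHom
    { toFun := fun x h => (Φ.app ⟨t.val + k, Nat.lt_succ_of_le h.down⟩).hom (x h)
      map_add' := by intro x y; ext h; simp
      map_smul' := by intro c x; ext h; simp }
  naturality {s t} f := by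
    refine ModuleCat.hom_ext (LinearMap.ext fun x => funext fun h => ?_)
    exact congrArg (fun φ => φ.hom (x ⟨(Nat.add_le_add_right (leOfHom f) k).trans h.down⟩))
      (Φ.naturality (homOfLE (Nat.add_le_add_right (leOfHom f) k) :
        (⟨s.val + k, Nat.lt_succ_of_le
            ((Nat.add_le_add_right (leOfHom f) k).trans h.down)⟩ : Fin (l + 1)) ⟶
          ⟨t.val + k, Nat.lt_succ_of_le h.down⟩))

/-- The morphism `V ⟶ V(k)` given by the inner morphisms `v_{t, t+k}`. -/
noncomputable def innerShift {F : Type u} [Field F] {l : ℕ} (k : ℕ) (V : PMod F l) :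
    V ⟶ shift k V where
  app t := ModuleCat.ofHom
    { toFun := fun x h =>
        (V.map (homOfLE (Nat.le_add_right t.val k) :
          t ⟶ (⟨t.val + k, Nat.lt_succ_of_le h.down⟩ : Fin (l + 1)))).hom x
      map_add' := by intro x y; ext h; simp
      map_smul' := by intro c x; ext h; simp }
  naturality {s t} f := by
    refine ModuleCat.hom_ext (LinearMap.ext fun x => funext fun h => ?_)
    change (V.map f ≫ V.map (homOfLE _)).hom x = (V.map (homOfLE _) ≫ V.map (homOfLE _)).hom x
    rw [← V.map_comp, ← V.map_comp]
    rfl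

/-- `Φ : V ⟶ W` is `δ`-invertible if there is `Ψ : W ⟶ V(2δ)` with `Ψ_t ∘ Φ_t = v_{t, t+2δ}` and
`Φ_{t+2δ} ∘ Ψ_t = w_{t, t+2δ}` for all `t`. As modules are indexed by integers, the shift `2δ` has
to be an integer. -/
def IsDeltaInvertible {F : Type u} [Field F] {l : ℕ} (δ : ℝ≥0) {V W : PMod F l}
    (Φ : V ⟶ W) : Prop :=
  ∃ k : ℕ, (k : ℝ≥0) = 2 * δ ∧ ∃ Ψ : W ⟶ shift k V,
    Φ ≫ Ψ = innerShift k V ∧ Ψ ≫ shiftMap k Φ = innerShift k W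

/-! ### Bars and nestedness -/

/-- The finite family of intervals `J` is the barcode of `V`: `V ≅ ⨁ₛ k_{J s}`. -/
def IsBarcode {F : Type u} [Field F] {l n : ℕ} (V : PMod F l) (J : Fin n → Bar l) : Prop :=
  Nonempty (V ≅ ⨁ fun s => intervalModule F (J s))

/-- The set of bars of `V`, i.e. of the intervals that appear in an interval decomposition of `V`
(which is unique up to reordering). -/
def bars {F : Type u} [Field F] {l : ℕ} (V : PMod F l) : Set (Bar l) :=
  {I | ∃ (n : ℕ) (J : Fin n → Bar l), IsBarcode V J ∧ ∃ s, J s = I}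

/-- The nestedness `Ξ(V)`: the minimum of `min (|a - c|, |b - d|)` over all pairs of bars
`[a, b]`, `[c, d]` of `V` with `[a, b]` strictly nested in `[c, d]`; it is `∞` if there is no such
pair. -/
noncomputable def nestedness {F : Type u} [Field F] {l : ℕ} (V : PMod F l) : ℕ∞ :=
  ⨅ (I : Bar l) (J : Bar l) (_ : I ∈ bars V) (_ : J ∈ bars V) (_ : StrictlyNested I J),
    ((min ((I.fst.val : ℤ) - J.fst.val).natAbs ((I.snd.val : ℤ) - J.snd.val).natAbs : ℕ) : ℕ∞)

/-! ### Ladder modules -/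

/-- Ladder persistence modules `(V, W, Φ)` are morphisms of persistence modules. Morphisms of
ladder persistence modules are commutative squares. -/
abbrev Ladder (F : Type u) [Field F] (l : ℕ) := Arrow (PMod F l)

/-- `R_{J₁}^{J₂}` for `J₁ ⪯ J₂`: the ladder `k_{J₂} ⟶ k_{J₁}` that is the identity of `F` at all
indices in `J₁ ∩ J₂` and zero at all others. -/
noncomputable def ladderR (F : Type u) [Field F] {l : ℕ} (J₁ J₂ : Bar l) (h : Overlaps J₁ J₂) :
    Ladder F l :=
  Arrow.mk (Y := intervalModule F J₁) (X := intervalModule F J₂)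
    { app := fun t => ModuleCat.ofHom (transfer F (t ∈ J₂) (t ∈ J₁))
      naturality := by
        intro s t f
        change ModuleCat.ofHom (transfer F (s ∈ J₂) (t ∈ J₂)) ≫
            ModuleCat.ofHom (transfer F (t ∈ J₂) (t ∈ J₁)) =
          ModuleCat.ofHom (transfer F (s ∈ J₂) (s ∈ J₁)) ≫
            ModuleCat.ofHom (transfer F (s ∈ J₁) (t ∈ J₁))
        rw [← ModuleCat.ofHom_comp, ← ModuleCat.ofHom_comp, transfer_comp, transfer_comp]
        · exact fun hs ht => ⟨h.1.trans hs.1, (leOfHom f).trans ht.2⟩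
        · exact fun hs ht => ⟨hs.1.trans (leOfHom f), ht.2.trans h.2.2⟩ }

/-- `I⁺_J`: the ladder `k_J ⟶ 0`. -/
noncomputable def ladderIPlus (F : Type u) [Field F] {l : ℕ} (J : Bar l) : Ladder F l :=
  Arrow.mk (0 : intervalModule F J ⟶ 0)

/-- `I⁻_K`: the ladder `0 ⟶ k_K`. -/
noncomputable def ladderIMinus (F : Type u) [Field F] {l : ℕ} (K : Bar l) : Ladder F l :=
  Arrow.mk (0 : 0 ⟶ intervalModule F K)

/-- The direct sum of a finite family of ladder persistence modules. -/
noncomputable def ladderSum {F : Type u} [Field F] {l : ℕ} {ι : Type} [Finite ι]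
    (L : ι → Ladder F l) : Ladder F l :=
  Arrow.mk (biproduct.map fun s => (L s).hom)

/-- The ladder module
`⨁_{J₁ ⪯ J₂} (R_{J₁}^{J₂})^{r(J₁, J₂)} ⊕ ⨁_J (I⁺_J)^{dPlus J} ⊕ ⨁_K (I⁻_K)^{dMinus K}`. -/
noncomputable def elementarySum (F : Type u) [Field F] {l : ℕ}
    (r : {p : Bar l × Bar l // Overlaps p.1 p.2} → ℕ) (dPlus dMinus : Bar l → ℕ) : Ladder F l :=
  ladderSum (ι := (Σ p, Fin (r p)) ⊕ (Σ J, Fin (dPlus J)) ⊕ (Σ K, Fin (dMinus K)))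
    (Sum.elim (fun x => ladderR F x.1.1.1 x.1.1.2 x.1.2)
      (Sum.elim (fun x => ladderIPlus F x.1) (fun x => ladderIMinus F x.1)))

end Persistence

/-! Induction on `totalDim V + totalDim W`, splitting off one elementary ladder at a time. If `Φ =
0`, any interval summand of `V` or `W` splits off. If `Φ ≠ 0`, interval decompositions of both sides
turn `Φ` into a matrix; a nonzero entry `k_J ⟶ k_K` forces `K ⪯ J` and is a scalar multiple of the
canonical map.

Put `k = 2δ`. By `exists_entry_ne_zero`, some nonzero entry has both endpoints of `J` at most `k`
beyond those of `K`: otherwise the `k`-inverse contributes nothing, all bars are shorter than `k`,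
and then every nonzero entry is of this kind after all. Among these entries take one with `J`
closest to `K`. Nested bars are more than `k` apart, so competing bars in its row or column cannot
be strictly nested with `J` or `K`, hence are comparable endpointwise, and minimality settles the
direction (`exists_ladderR_retract`). All other entries of the row and column then factor through
this pivot, and `R_K^J` is a retract of `Φ` (`exists_retract_of_pivot`).

The complement inherits `δ`-invertibility (`IsDeltaInvertible.of_retract`), and its bars are bars of
`V` and `W`, so the induction continues with the same `k`. -/

namespace Persistence

/-! ### Splitting off direct summands -/

section Splitting

universe v w

variable {C : Type w} [Category.{v} C] [Preadditive C]

/-- A decomposition of `X` as a direct sum of `A` and `B`. -/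
structure Decomposition (X A B : C) where
  /-- The inclusion of the first summand. -/
  inl : A ⟶ X
  /-- The projection to the first summand. -/
  fst : X ⟶ A
  /-- The inclusion of the second summand. -/
  inr : B ⟶ X
  /-- The projection to the second summand. -/
  snd : X ⟶ B
  inl_fst : inl ≫ fst = 𝟙 A
  inr_snd : inr ≫ snd = 𝟙 B
  inl_snd : inl ≫ snd = 0
  inr_fst : inr ≫ fst = 0
  total : fst ≫ inl + snd ≫ inr = 𝟙 X

attribute [simp] Decomposition.inl_fst Decomposition.inr_snd Decomposition.inl_snd
  Decomposition.inr_fst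

/-- The kernel of the retraction is a complement of a retract. -/
noncomputable def Decomposition.ofRetract {A X : C} (i : A ⟶ X) (r : X ⟶ A) [HasKernel r]
    (h : i ≫ r = 𝟙 A) : Decomposition X A (kernel r) where
  inl := i
  fst := r
  inr := kernel.ι r
  snd := kernel.lift r (𝟙 X - r ≫ i) (by simp [h])
  inl_fst := h
  inr_snd := by
    rw [← cancel_mono (kernel.ι r)]
    simp
  inl_snd := by
    rw [← cancel_mono (kernel.ι r)]
    simp [reassoc_of% h]
  inr_fst := kernel.condition r
  total := by simp

/-- Adjoining one summand to a finite direct sum. -/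
noncomputable def Decomposition.isoOption [HasFiniteBiproducts C] {ι : Type} [Finite ι]
    {f : Option ι → C} {X B : C} (D : Decomposition X (f none) B)
    (e : B ≅ ⨁ fun i => f (some i)) : X ≅ ⨁ f where
  hom := biproduct.lift fun j => match j with
    | none => D.fst
    | some i => D.snd ≫ e.hom ≫ biproduct.π (fun i => f (some i)) i
  inv := biproduct.desc fun j => match j with
    | none => D.inl
    | some i => biproduct.ι (fun i => f (some i)) i ≫ e.inv ≫ D.inr
  hom_inv_id := by
    have := Fintype.ofFinite ι
    have h : D.snd ≫ e.hom ≫ (∑ i, biproduct.π (fun i => f (some i)) i ≫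
        biproduct.ι (fun i => f (some i)) i) ≫ e.inv ≫ D.inr = D.snd ≫ D.inr := by
      rw [biproduct.total]
      simp
    rw [biproduct.lift_desc, Fintype.sum_option, ← D.total, ← h]
    simp only [Preadditive.sum_comp, Preadditive.comp_sum, Category.assoc]
  inv_hom_id := by
    refine biproduct.hom_ext' _ _ fun a => biproduct.hom_ext _ _ fun b => ?_
    rcases a with _ | a <;> rcases b with _ | b
    · simp
    · simp [reassoc_of% D.inl_snd]
    · simp
    · by_cases h : a = b
      · subst h
        simp [reassoc_of% D.inr_snd]
      · simp [reassoc_of% D.inr_snd, biproduct.ι_π_ne _ h,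
          biproduct.ι_π_ne f fun hab => h (Option.some.inj hab)]

/-- The hypotheses `hfst` and `hsnd` say that `Φ` is block diagonal, so the square can be checked
one projection at a time. -/
theorem Decomposition.isoOption_hom_naturality [HasFiniteBiproducts C] {ι : Type} [Finite ι]
    {f g : Option ι → C} (φ : ∀ o, f o ⟶ g o) {V W V' W' : C} {Φ : V ⟶ W} {Φ' : V' ⟶ W'}
    (D : Decomposition V (f none) V') (E : Decomposition W (g none) W')
    (hfst : Φ ≫ E.fst = D.fst ≫ φ none) (hsnd : Φ ≫ E.snd = D.snd ≫ Φ')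
    (e : V' ≅ ⨁ fun i => f (some i)) (e' : W' ≅ ⨁ fun i => g (some i))
    (he : e.hom ≫ biproduct.map (fun i => φ (some i)) = Φ' ≫ e'.hom) :
    (D.isoOption e).hom ≫ biproduct.map φ = Φ ≫ (E.isoOption e').hom := by
  refine biproduct.hom_ext _ _ fun j => ?_
  rcases j with _ | j
  · simp [Decomposition.isoOption, hfst]
  · have := he =≫ biproduct.π _ j
    simp only [Category.assoc, biproduct.map_π] at this
    simp [Decomposition.isoOption, this, reassoc_of% hsnd]

/-- Adjoining one summand to a decomposition of an arrow into a finite direct sum. -/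
noncomputable def arrowIsoOption [HasFiniteBiproducts C] {ι : Type} [Finite ι]
    {L : Option ι → Arrow C} {V W V' W' : C} {Φ : V ⟶ W} {Φ' : V' ⟶ W'}
    (D : Decomposition V (L none).left V') (E : Decomposition W (L none).right W')
    (hfst : Φ ≫ E.fst = D.fst ≫ (L none).hom) (hsnd : Φ ≫ E.snd = D.snd ≫ Φ')
    (e : Arrow.mk Φ' ≅ Arrow.mk (biproduct.map fun i => (L (some i)).hom)) :
    Arrow.mk Φ ≅ Arrow.mk (biproduct.map fun i => (L i).hom) :=
  Arrow.isoMk (D.isoOption (f := fun i => (L i).left) (Arrow.leftFunc.mapIso e))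
    (E.isoOption (f := fun i => (L i).right) (Arrow.rightFunc.mapIso e))
    (D.isoOption_hom_naturality (fun i => (L i).hom) E hfst hsnd _ _ e.hom.w)

/-- A retract of an arrow splits off as a direct summand. -/
theorem exists_decomposition_of_retract [HasKernels C] {V W : C} {Φ : V ⟶ W} {L : Arrow C}
    (i : L ⟶ Arrow.mk Φ) (r : Arrow.mk Φ ⟶ L) (h : i ≫ r = 𝟙 L) :
    ∃ (V' W' : C) (Φ' : V' ⟶ W') (D : Decomposition V L.left V')
      (E : Decomposition W L.right W'), Φ ≫ E.fst = D.fst ≫ L.hom ∧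
        Φ ≫ E.snd = D.snd ≫ Φ' ∧ D.inr ≫ Φ = Φ' ≫ E.inr := by
  -- Split source and target separately; `Φ` is block diagonal because `i` and `r` are commutative
  -- squares.
  let D : Decomposition V L.left _ := Decomposition.ofRetract i.left r.left (congrArg (·.left) h)
  let E : Decomposition W L.right _ :=
    Decomposition.ofRetract i.right r.right (congrArg (·.right) h)
  have hfst : Φ ≫ E.fst = D.fst ≫ L.hom := r.w.symm
  have hinl : D.inl ≫ Φ = L.hom ≫ E.inl := i.w
  refine ⟨_, _, D.inr ≫ Φ ≫ E.snd, D, E, hfst, ?_, ?_⟩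
  · have := D.total =≫ (Φ ≫ E.snd)
    simp only [Preadditive.add_comp, Category.assoc, reassoc_of% hinl, E.inl_snd, comp_zero,
      zero_add, Category.id_comp] at this
    exact this.symm
  · have := (D.inr ≫ Φ) ≫= E.total
    simp only [Preadditive.comp_add, Category.assoc, reassoc_of% hfst,
      reassoc_of% D.inr_fst, zero_comp,
      zero_add, Category.comp_id] at this
    simp only [Category.assoc]
    exact this.symm

end Splitting

/-! ### Interval decompositions -/

variable {F : Type u} [Field F] {l : ℕ}

/-- The total dimension of a persistence module. -/
noncomputable def totalDim (V : PMod F l) : ℕ := ∑ t, Module.finrank F (V.obj t)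

theorem Decomposition.app_inr_injective {V A B : PMod F l} (D : Decomposition V A B)
    (t : Fin (l + 1)) : Function.Injective (D.inr.app t).hom := by
  have h := congrArg (fun φ => (φ.app t).hom) D.inr_snd
  exact Function.LeftInverse.injective (g := (D.snd.app t).hom) fun x => congrArg (· x) h

theorem IsPFD.of_decomposition {V A B : PMod F l} (hV : IsPFD V) (D : Decomposition V A B) :
    IsPFD B := fun t =>
  have := hV t
  FiniteDimensional.of_injective (D.inr.app t).hom (D.app_inr_injective t)

theorem totalDim_le {V A B : PMod F l} (hV : IsPFD V) (D : Decomposition V A B) :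
    totalDim B ≤ totalDim V :=
  Finset.sum_le_sum fun t _ =>
    have := hV t
    LinearMap.finrank_le_finrank_of_injective (D.app_inr_injective t)

theorem totalDim_lt {V A B : PMod F l} (hV : IsPFD V) (D : Decomposition V A B)
    {t : Fin (l + 1)} (ht : Nontrivial (A.obj t)) : totalDim B < totalDim V := by
  refine Finset.sum_lt_sum (fun s _ => ?_) ⟨t, Finset.mem_univ t, ?_⟩
  · have := hV s
    exact LinearMap.finrank_le_finrank_of_injective (D.app_inr_injective s)
  · have := hV t
    have := hV.of_decomposition D t
    -- With equal dimensions `B` would fill `V` at `t`, so `A` would sit inside `B`, on which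
    -- `D.fst` vanishes.
    refine (LinearMap.finrank_le_finrank_of_injective (D.app_inr_injective t)).lt_of_ne fun h => ?_
    have hs := (LinearMap.injective_iff_surjective_of_finrank_eq_finrank h).1
      (D.app_inr_injective t)
    obtain ⟨a, ha⟩ := exists_ne (0 : A.obj t)
    obtain ⟨b, hb⟩ := hs ((D.inl.app t).hom a)
    have h₁ : (D.fst.app t).hom ((D.inl.app t).hom a) = a :=
      congrArg (fun φ => (φ.app t).hom a) D.inl_fst
    have h₂ : (D.fst.app t).hom ((D.inr.app t).hom b) = 0 :=
      congrArg (fun φ => (φ.app t).hom b) D.inr_fst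
    rw [hb, h₁] at h₂
    exact ha h₂

theorem nontrivial_intervalModule {J : Bar l} {t : Fin (l + 1)} (ht : t ∈ J) :
    Nontrivial ((intervalModule F J).obj t) :=
  have : Nonempty (PLift (t ∈ J)) := ⟨⟨ht⟩⟩
  inferInstanceAs (Nontrivial (PLift (t ∈ J) → F))

theorem subsingleton_intervalModule {J : Bar l} {t : Fin (l + 1)} (ht : t ∉ J) :
    Subsingleton ((intervalModule F J).obj t) :=
  have : IsEmpty (PLift (t ∈ J)) := ⟨fun h => ht h.down⟩
  inferInstanceAs (Subsingleton (PLift (t ∈ J) → F))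

theorem map_map_apply (V : PMod F l) {r s t : Fin (l + 1)} (f : r ⟶ s) (g : s ⟶ t) (h : r ⟶ t)
    (x : V.obj r) : (V.map g).hom ((V.map f).hom x) = (V.map h).hom x := by
  rw [Subsingleton.elim h (f ≫ g), V.map_comp]
  rfl

theorem map_self_apply (V : PMod F l) {t : Fin (l + 1)} (f : t ⟶ t) (x : V.obj t) :
    (V.map f).hom x = x := by
  rw [Subsingleton.elim f (𝟙 t), V.map_id]
  rfl

open Classical in
/-- The morphism out of an interval module given by an element that dies after the interval. -/
noncomputable def fromInterval (J : Bar l) (V : PMod F l) (x : V.obj J.fst)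
    (hx : ∀ (t : Fin (l + 1)) (h : J.fst ≤ t), J.snd < t → (V.map (homOfLE h)).hom x = 0) :
    intervalModule F J ⟶ V where
  app t := ModuleCat.ofHom (X := PLift (t ∈ J) → F)
    { toFun := fun y => if h : t ∈ J then y ⟨h⟩ • (V.map (homOfLE h.1)).hom x else 0
      map_add' := by intro y z; by_cases h : t ∈ J <;> simp [h, add_smul]
      map_smul' := by intro c y; by_cases h : t ∈ J <;> simp [h, mul_smul] }
  naturality s t f := by
    refine ModuleCat.hom_ext (LinearMap.ext fun (y : PLift (s ∈ J) → F) => ?_)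
    change (if h : t ∈ J then transfer F (s ∈ J) (t ∈ J) y ⟨h⟩ • (V.map (homOfLE h.1)).hom x
      else 0) = (V.map f).hom (if h : s ∈ J then y ⟨h⟩ • (V.map (homOfLE h.1)).hom x else 0)
    by_cases hs : s ∈ J
    · rw [dif_pos hs, map_smul, map_map_apply V _ f (homOfLE (hs.1.trans (leOfHom f)))]
      by_cases ht : t ∈ J
      · simp [transfer, hs, ht]
      · have hlt : J.snd < t := not_le.1 fun h => ht ⟨hs.1.trans (leOfHom f), h⟩
        rw [dif_neg ht, hx t _ hlt, smul_zero]
    · simp [transfer, hs]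

/-- The morphism to an interval module given by a functional that vanishes on all elements born
before the interval. -/
noncomputable def toInterval (J : Bar l) (V : PMod F l) (ξ : V.obj J.snd →ₗ[F] F)
    (hξ : ∀ (t : Fin (l + 1)) (h : t ≤ J.snd), t < J.fst → ξ.comp (V.map (homOfLE h)).hom = 0) :
    V ⟶ intervalModule F J where
  app t := ModuleCat.ofHom (LinearMap.pi fun h : PLift (t ∈ J) =>
    ξ.comp (V.map (homOfLE h.down.2)).hom)
  naturality s t f := by
    refine ModuleCat.hom_ext (LinearMap.ext fun x => funext fun (h : PLift (t ∈ J)) => ?_)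
    have hle : s ≤ J.snd := (leOfHom f).trans h.down.2
    change ξ ((V.map (homOfLE h.down.2)).hom ((V.map f).hom x)) = transfer F (s ∈ J) (t ∈ J)
      (fun h : PLift (s ∈ J) => ξ ((V.map (homOfLE h.down.2)).hom x)) h
    rw [map_map_apply V f _ (homOfLE hle)]
    by_cases hs : s ∈ J
    · simp [transfer, hs]
    · have hlt : s < J.fst := not_le.1 fun h => hs ⟨h, hle⟩
      simpa [transfer, hs] using congrArg (· x) (hξ s hle hlt)

/-- A nonzero persistence module has an interval module as a retract. -/
theorem exists_interval_retract (V : PMod F l) (hV : ∃ t, Nontrivial (V.obj t)) :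
    ∃ (J : Bar l) (i : intervalModule F J ⟶ V) (r : V ⟶ intervalModule F J),
      i ≫ r = 𝟙 (intervalModule F J) := by
  classical
  -- `a` is the earliest index with a nonzero space, so nothing is born before it and any functional
  -- at `b` defines a projection; `b` is the last index at which `x` survives.
  obtain ⟨a, ha, hmin⟩ := WellFounded.has_min (wellFounded_lt (α := Fin (l + 1)))
    {t | Nontrivial (V.obj t)} hV
  have ha : Nontrivial (V.obj a) := ha
  obtain ⟨x, hx⟩ := exists_ne (0 : V.obj a)
  obtain ⟨b, ⟨hab, hb⟩, hmax⟩ := WellFounded.has_min (wellFounded_gt (α := Fin (l + 1)))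
    {t | ∃ h : a ≤ t, (V.map (homOfLE h)).hom x ≠ 0}
    ⟨a, le_rfl, by rwa [map_self_apply]⟩
  obtain ⟨ξ, hξ⟩ := Module.Projective.exists_dual_eq_one F hb
  let J : Bar l := ⟨(a, b), hab⟩
  refine ⟨J, fromInterval J V x fun t h ht => by_contra fun h' => hmax t ⟨h, h'⟩ ht,
    toInterval J V ξ fun t h ht => LinearMap.ext fun y => ?_, ?_⟩
  · have : Subsingleton (V.obj t) := not_nontrivial_iff_subsingleton.1 fun h => hmin t h ht
    rw [Subsingleton.elim y 0, map_zero, map_zero]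
  · refine NatTrans.ext (funext fun t => ModuleCat.hom_ext (LinearMap.ext
      fun (y : PLift (t ∈ J) → F) => funext fun (h : PLift (t ∈ J)) => ?_))
    change ξ ((V.map (homOfLE h.down.2)).hom
      (if h : t ∈ J then y ⟨h⟩ • (V.map (homOfLE h.1)).hom x else 0)) = y h
    rw [dif_pos h.down, map_smul, map_map_apply V _ _ (homOfLE hab), map_smul, hξ, smul_eq_mul,
      mul_one]

theorem isZero_of_forall_not_nontrivial {V : PMod F l} (h : ¬ ∃ t, Nontrivial (V.obj t)) :
    IsZero V := Functor.isZero _ fun t =>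
  have := not_nontrivial_iff_subsingleton.1 fun ht => h ⟨t, ht⟩
  ModuleCat.isZero_of_subsingleton _

/-- A decomposition of a persistence module as a direct sum of interval modules, over an arbitrary
finite index type, is a barcode up to reindexing. -/
theorem IsBarcode.of_iso {ι : Type} [Finite ι] {V : PMod F l} {J : ι → Bar l}
    (e : V ≅ ⨁ fun s => intervalModule F (J s)) :
    ∃ (n : ℕ) (σ : Fin n ≃ ι), IsBarcode V (J ∘ σ) := by
  obtain ⟨n, ⟨σ⟩⟩ := Finite.exists_equiv_fin ι
  exact ⟨n, σ.symm, ⟨e ≪≫ (biproduct.whiskerEquiv (f := fun s => intervalModule F ((J ∘ σ.symm) s))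
    σ.symm fun _ => Iso.refl _).symm⟩⟩

theorem mem_bars_of_iso {ι : Type} [Finite ι] {V : PMod F l} {J : ι → Bar l}
    (e : V ≅ ⨁ fun s => intervalModule F (J s)) (s : ι) : J s ∈ bars V := by
  obtain ⟨n, σ, h⟩ := IsBarcode.of_iso e
  exact ⟨n, J ∘ σ, h, σ.symm s, by simp⟩

/-- Pointwise finite dimensional persistence modules are direct sums of interval modules. -/
theorem exists_isBarcode (V : PMod F l) (hV : IsPFD V) :
    ∃ (n : ℕ) (J : Fin n → Bar l), IsBarcode V J := by
  induction hn : totalDim V using Nat.strong_induction_on generalizing V with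
  | _ n ih =>
    by_cases h : ∃ t, Nontrivial (V.obj t)
    · obtain ⟨J, i, r, hir⟩ := exists_interval_retract V h
      have D := Decomposition.ofRetract i r hir
      obtain ⟨m, J', ⟨e⟩⟩ := ih _ (hn ▸ totalDim_lt hV D
        (nontrivial_intervalModule (t := J.fst) ⟨le_rfl, J.fst_le_snd⟩)) _
        (hV.of_decomposition D) rfl
      obtain ⟨n, σ, h⟩ := IsBarcode.of_iso (J := fun o : Option (Fin m) => o.elim J J')
        (D.isoOption e)
      exact ⟨n, _, h⟩
    · exact ⟨0, Fin.elim0, ⟨(isZero_of_forall_not_nontrivial h).iso ((IsZero.iff_id_eq_zero _).2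
        (biproduct.hom_ext _ _ fun j => j.elim0))⟩⟩

/-- A decomposition of the complement together with `J` is one of `V`. As `bars` ranges over all
decompositions, no uniqueness of barcodes is needed. -/
theorem bars_subset_of_decomposition {V B : PMod F l} {J : Bar l}
    (D : Decomposition V (intervalModule F J) B) : bars B ⊆ bars V := by
  rintro _ ⟨n, J', ⟨e⟩, s, rfl⟩
  exact mem_bars_of_iso (J := fun o : Option (Fin n) => o.elim J J') (D.isoOption e) (some s)

theorem bars_subset_of_isZero {V A B : PMod F l} (hA : IsZero A) (D : Decomposition V A B) :
    bars B ⊆ bars V := by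
  rintro _ ⟨n, J', ⟨e⟩, s, rfl⟩
  have h : D.snd ≫ D.inr = 𝟙 V := by
    rw [← D.total, hA.eq_of_tgt D.fst 0, zero_comp, zero_add]
  exact mem_bars_of_iso (Iso.mk D.snd D.inr h D.inr_snd ≪≫ e) s

/-! ### Shifts -/

theorem shiftMap_comp (k : ℕ) {U V W : PMod F l} (f : U ⟶ V) (g : V ⟶ W) :
    shiftMap k (f ≫ g) = shiftMap k f ≫ shiftMap k g := rfl

theorem shiftMap_add (k : ℕ) {V W : PMod F l} (f g : V ⟶ W) :
    shiftMap k (f + g) = shiftMap k f + shiftMap k g := rfl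

theorem shiftMap_zero (k : ℕ) (V W : PMod F l) : shiftMap k (0 : V ⟶ W) = 0 := rfl

theorem shiftMap_sum (k : ℕ) {V W : PMod F l} {ι : Type} (s : Finset ι) (f : ι → (V ⟶ W)) :
    shiftMap k (∑ i ∈ s, f i) = ∑ i ∈ s, shiftMap k (f i) :=
  map_sum (AddMonoidHom.mk' (shiftMap k) (shiftMap_add k)) f s

theorem innerShift_naturality (k : ℕ) {V W : PMod F l} (f : V ⟶ W) :
    innerShift k V ≫ shiftMap k f = f ≫ innerShift k W := by
  refine NatTrans.ext (funext fun t => ModuleCat.hom_ext (LinearMap.ext fun x =>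
    funext fun h => ?_))
  exact congrArg (fun φ => φ.hom x) (f.naturality (homOfLE (Nat.le_add_right t.val k) :
    t ⟶ (⟨t.val + k, Nat.lt_succ_of_le h.down⟩ : Fin (l + 1))))

/-- Compressing `Ψ` to `j ≫ Ψ ≫ p(k)` gives an inverse, since inner shifts are natural. -/
theorem IsDeltaInvertible.of_retract {δ : ℝ≥0} {V W V' W' : PMod F l} {Φ : V ⟶ W} {Φ' : V' ⟶ W'}
    (hΦ : IsDeltaInvertible δ Φ) {i : V' ⟶ V} {p : V ⟶ V'} {j : W' ⟶ W} {q : W ⟶ W'}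
    (hip : i ≫ p = 𝟙 V') (hjq : j ≫ q = 𝟙 W') (hij : i ≫ Φ = Φ' ≫ j) (hpq : Φ ≫ q = p ≫ Φ') :
    IsDeltaInvertible δ Φ' := by
  obtain ⟨k, hk, Ψ, h₁, h₂⟩ := hΦ
  refine ⟨k, hk, j ≫ Ψ ≫ shiftMap k p, ?_, ?_⟩
  · rw [← reassoc_of% hij, reassoc_of% h₁, innerShift_naturality, reassoc_of% hip]
  · simp only [Category.assoc]
    rw [← shiftMap_comp, ← hpq, shiftMap_comp, reassoc_of% h₂, innerShift_naturality,
      reassoc_of% hjq]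

/-! ### Morphisms between interval modules -/

theorem intervalModule_map_surjective {J : Bar l} {s t : Fin (l + 1)} (f : s ⟶ t) (hs : J.fst ≤ s) :
    Function.Surjective ((intervalModule F J).map f).hom := by
  intro (y : PLift (t ∈ J) → F)
  refine ⟨transfer F (t ∈ J) (s ∈ J) y, funext fun (h : PLift (t ∈ J)) => ?_⟩
  have hsJ : s ∈ J := ⟨hs, (leOfHom f).trans h.down.2⟩
  change transfer F (s ∈ J) (t ∈ J) (transfer F (t ∈ J) (s ∈ J) y) h = y h
  simp [transfer, hsJ, h.down]

theorem intervalModule_map_injective {J : Bar l} {s t : Fin (l + 1)} (f : s ⟶ t) (ht : t ≤ J.snd) :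
    Function.Injective ((intervalModule F J).map f).hom := by
  intro (x : PLift (s ∈ J) → F) (y : PLift (s ∈ J) → F) hxy
  refine funext fun (h : PLift (s ∈ J)) => ?_
  have htJ : t ∈ J := ⟨h.down.1.trans (leOfHom f), ht⟩
  have := congrFun (show transfer F (s ∈ J) (t ∈ J) x = transfer F (s ∈ J) (t ∈ J) y from hxy) ⟨htJ⟩
  simpa [transfer, h.down] using this

/-- An interval module is generated at its left endpoint. -/
theorem intervalModule_hom_ext {J : Bar l} {X : PMod F l} {f g : intervalModule F J ⟶ X}
    (h : ∀ y, (f.app J.fst).hom y = (g.app J.fst).hom y) : f = g := by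
  refine NatTrans.ext (funext fun t => ModuleCat.hom_ext (LinearMap.ext fun y => ?_))
  by_cases ht : t ∈ J
  · obtain ⟨x, rfl⟩ := intervalModule_map_surjective (homOfLE ht.1) le_rfl y
    have hf := congrArg (fun φ => φ.hom x) (f.naturality (homOfLE ht.1))
    have hg := congrArg (fun φ => φ.hom x) (g.naturality (homOfLE ht.1))
    exact hf.trans ((congrArg (X.map (homOfLE ht.1)).hom (h x)).trans hg.symm)
  · have := subsingleton_intervalModule (F := F) ht
    rw [Subsingleton.elim y 0, map_zero, map_zero]

/-- The generator of `k_J` is dead at `t₀`, so by injectivity its image is already zero at `J.fst`.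
-/
theorem intervalModule_hom_eq_zero {J : Bar l} {X : PMod F l} {t₀ : Fin (l + 1)} (h₀ : J.snd < t₀)
    (hX : ∀ t ∈ J, ∀ f : t ⟶ t₀, Function.Injective (X.map f).hom) (g : intervalModule F J ⟶ X) :
    g = 0 := by
  have hJ : J.fst ∈ J := ⟨le_rfl, J.fst_le_snd⟩
  refine intervalModule_hom_ext fun y => hX _ hJ (homOfLE (J.fst_le_snd.trans h₀.le)) ?_
  have := subsingleton_intervalModule (F := F) (J := J) (t := t₀) fun h => h₀.not_ge h.2
  refine (congrArg (fun φ => φ.hom y)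
    (g.naturality (homOfLE (J.fst_le_snd.trans h₀.le)))).symm.trans ?_
  change (g.app t₀).hom (((intervalModule F J).map _).hom y) = (X.map _).hom 0
  rw [Subsingleton.elim (((intervalModule F J).map _).hom y) 0, map_zero, map_zero]

/-- A nonzero morphism `k_J ⟶ k_K` only exists if `K ⪯ J`. -/
theorem overlaps_of_hom_ne_zero {J K : Bar l} {g : intervalModule F J ⟶ intervalModule F K}
    (hg : g ≠ 0) : Overlaps K J := by
  have hJK : J.fst ∈ K := by_contra fun h => hg <| intervalModule_hom_ext fun y =>
    (subsingleton_intervalModule h).elim _ _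
  refine ⟨hJK.1, hJK.2, not_lt.1 fun h => hg ?_⟩
  exact intervalModule_hom_eq_zero h (fun t _ f => intervalModule_map_injective f le_rfl) g

variable (F) in
/-- The morphism `k_J ⟶ k_K` for `K ⪯ J` that is the identity of `F` on `J ∩ K`. -/
noncomputable def intervalMap {J K : Bar l} (h : Overlaps K J) :
    intervalModule F J ⟶ intervalModule F K :=
  (ladderR F K J h).hom

theorem hom_eq_smul {J K : Bar l} (h : Overlaps K J)
    (g : intervalModule F J ⟶ intervalModule F K) : ∃ c : F, g = c • intervalMap F h := by
  have hJ : J.fst ∈ J := ⟨le_rfl, J.fst_le_snd⟩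
  have hK : J.fst ∈ K := ⟨h.1, h.2.1⟩
  let G : (PLift (J.fst ∈ J) → F) →ₗ[F] (PLift (J.fst ∈ K) → F) := (g.app J.fst).hom
  refine ⟨G 1 ⟨hK⟩, intervalModule_hom_ext fun (y : PLift (J.fst ∈ J) → F) =>
    funext fun (_ : PLift (J.fst ∈ K)) => ?_⟩
  change G y ⟨hK⟩ = G 1 ⟨hK⟩ * transfer F (J.fst ∈ J) (J.fst ∈ K) y ⟨hK⟩
  have hy : y = y ⟨hJ⟩ • 1 := funext fun _ => by simp
  conv_lhs => rw [hy, map_smul]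
  simp [transfer, hJ, mul_comm]

/-- Every index of `J ∩ L` lies in `K`. Beyond `h₁` and `h₂`, the hypothesis `h₃` only adds that `J`
and `L` meet. -/
theorem intervalMap_comp {J K L : Bar l} (h₁ : Overlaps K J) (h₂ : Overlaps L K)
    (h₃ : Overlaps L J) :
    intervalMap F h₁ ≫ intervalMap F h₂ = intervalMap F h₃ := by
  refine NatTrans.ext (funext fun t => ?_)
  change ModuleCat.ofHom (transfer F (t ∈ J) (t ∈ K)) ≫
      ModuleCat.ofHom (transfer F (t ∈ K) (t ∈ L)) =
    ModuleCat.ofHom (transfer F (t ∈ J) (t ∈ L))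
  rw [← ModuleCat.ofHom_comp, transfer_comp]
  exact fun hJ hL => ⟨h₁.1.trans hJ.1, hL.2.trans h₂.2.2⟩

/-- A nonzero morphism `k_K ⟶ k_J(k)` only exists if the endpoints of `J` exceed those of `K` by at
most `k`. -/
theorem le_add_of_hom_shift_ne_zero {J K : Bar l} {k : ℕ}
    {g : intervalModule F K ⟶ shift k (intervalModule F J)} (hg : g ≠ 0) :
    J.fst.val ≤ K.fst.val + k ∧ J.snd.val ≤ K.snd.val + k := by
  constructor
  · refine not_lt.1 fun h => hg <| intervalModule_hom_ext fun y => funext fun hl => ?_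
    exact (subsingleton_intervalModule fun hJ => (Fin.lt_def.2 h).not_ge hJ.1).elim _ _
  · refine not_lt.1 fun h => hg ?_
    have hl := J.snd.isLt
    -- The first index past `K`: `k_K` is dead there, while `k_J(k)` is still alive because `K.snd +
    -- k < J.snd`; the latter also bounds `t₀` by `l`.
    let t₀ : Fin (l + 1) := ⟨K.snd.val + 1, by omega⟩
    refine intervalModule_hom_eq_zero (t₀ := t₀) (Fin.lt_def.2 (Nat.lt_succ_self _))
      (fun t _ f x y hxy => funext fun ht => ?_) g
    have h₀ : t₀.val + k ≤ l := by
      change K.snd.val + 1 + k ≤ l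
      omega
    refine intervalModule_map_injective
      (homOfLE (Nat.add_le_add_right (leOfHom f) k) : _ ⟶ (⟨t₀.val + k, Nat.lt_succ_of_le h₀⟩ :
        Fin (l + 1))) ?_ (congrFun hxy ⟨h₀⟩)
    change K.snd.val + 1 + k ≤ J.snd.val
    omega

/-- The generator at `J.fst` survives to `J.fst + k`. -/
theorem innerShift_intervalModule_ne_zero {J : Bar l} {k : ℕ} (h : J.fst.val + k ≤ J.snd.val) :
    innerShift k (intervalModule F J) ≠ 0 := by
  intro h0
  have hl : J.fst.val + k ≤ l := h.trans (Nat.le_of_lt_succ J.snd.isLt)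
  have hJ : J.fst ∈ J := ⟨le_rfl, J.fst_le_snd⟩
  have hJ' : (⟨J.fst.val + k, Nat.lt_succ_of_le hl⟩ : Fin (l + 1)) ∈ J :=
    ⟨Fin.le_def.2 (Nat.le_add_right _ _), Fin.le_def.2 h⟩
  have := congrFun (congrArg (fun φ => (φ.app J.fst).hom fun _ => (1 : F)) h0) ⟨hl⟩
  have h1 : transfer F (J.fst ∈ J) (_ ∈ J) (fun _ => 1) ⟨hJ'⟩ = 0 := congrFun this ⟨hJ'⟩
  simp [transfer, hJ] at h1

/-! ### Bases of interval modules -/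

/-- An explicit decomposition of `V` as a direct sum of interval modules. -/
structure BarBasis (V : PMod F l) (ι : Type) [Fintype ι] where
  /-- The bars. -/
  bar : ι → Bar l
  /-- The inclusions of the summands. -/
  incl : ∀ s, intervalModule F (bar s) ⟶ V
  /-- The projections to the summands. -/
  proj : ∀ s, V ⟶ intervalModule F (bar s)
  incl_proj : ∀ s, incl s ≫ proj s = 𝟙 _
  incl_proj_ne : ∀ s t, s ≠ t → incl s ≫ proj t = 0
  total : ∑ s, proj s ≫ incl s = 𝟙 V

theorem exists_barBasis (V : PMod F l) (hV : IsPFD V) :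
    ∃ (n : ℕ) (D : BarBasis V (Fin n)), ∀ s, D.bar s ∈ bars V := by
  obtain ⟨n, J, ⟨e⟩⟩ := exists_isBarcode V hV
  refine ⟨n, { bar := J
               incl := fun s => biproduct.ι (fun s => intervalModule F (J s)) s ≫ e.inv
               proj := fun s => e.hom ≫ biproduct.π _ s
               incl_proj := fun s => by simp
               incl_proj_ne := fun s t h => by simp [biproduct.ι_π_ne _ h]
               total := ?_ }, fun s => mem_bars_of_iso e s⟩
  have : e.hom ≫ (∑ s, biproduct.π (fun s => intervalModule F (J s)) s ≫
      biproduct.ι (fun s => intervalModule F (J s)) s) ≫ e.inv = 𝟙 V := by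
    rw [biproduct.total]
    simp
  rw [← this]
  simp only [Preadditive.sum_comp, Preadditive.comp_sum, Category.assoc]

/-! ### Matrices of morphisms and pivots -/

section Matrix

variable {V W : PMod F l} {ι κ : Type} [Fintype ι] [Fintype κ]

/-- The entries of the matrix of a morphism. -/
noncomputable def entry (D : BarBasis V ι) (E : BarBasis W κ) (Φ : V ⟶ W) (s : ι) (t : κ) :
    intervalModule F (D.bar s) ⟶ intervalModule F (E.bar t) :=
  D.incl s ≫ Φ ≫ E.proj t

theorem sum_proj_entry (D : BarBasis V ι) (E : BarBasis W κ) (Φ : V ⟶ W) (t : κ) :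
    ∑ s, D.proj s ≫ entry D E Φ s t = Φ ≫ E.proj t := by
  have := D.total =≫ (Φ ≫ E.proj t)
  simpa [Preadditive.sum_comp, entry] using this

theorem sum_entry_incl (D : BarBasis V ι) (E : BarBasis W κ) (Φ : V ⟶ W) (s : ι) :
    ∑ t, entry D E Φ s t ≫ E.incl t = D.incl s ≫ Φ := by
  have := (D.incl s ≫ Φ) ≫= E.total
  simpa [Preadditive.comp_sum, entry] using this

theorem eq_zero_of_entry_eq_zero (D : BarBasis V ι) (E : BarBasis W κ) (Φ : V ⟶ W)
    (h : ∀ s t, entry D E Φ s t = 0) : Φ = 0 := by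
  have h₁ : ∀ t, Φ ≫ E.proj t = 0 := fun t => by simp [← sum_proj_entry D, h]
  have := Φ ≫= E.total
  simpa [Preadditive.comp_sum, reassoc_of% h₁] using this.symm

/-- An entry that is minimal in its row and maximal in its column splits off. -/
theorem exists_retract_of_pivot (D : BarBasis V ι) (E : BarBasis W κ) (Φ : V ⟶ W) (s : ι) (t : κ)
    (hst : entry D E Φ s t ≠ 0)
    (hrow : ∀ s', entry D E Φ s' t ≠ 0 →
      (D.bar s).fst ≤ (D.bar s').fst ∧ (D.bar s).snd ≤ (D.bar s').snd)
    (hcol : ∀ t', entry D E Φ s t' ≠ 0 →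
      (E.bar t').fst ≤ (E.bar t).fst ∧ (E.bar t').snd ≤ (E.bar t).snd) :
    ∃ (h : Overlaps (E.bar t) (D.bar s)) (i : ladderR F (E.bar t) (D.bar s) h ⟶ Arrow.mk Φ)
      (r : Arrow.mk Φ ⟶ ladderR F (E.bar t) (D.bar s) h), i ≫ r = 𝟙 _ := by
  classical
  have h := overlaps_of_hom_ne_zero hst
  obtain ⟨c, hc⟩ := hom_eq_smul h (entry D E Φ s t)
  have hc0 : c ≠ 0 := by
    rintro rfl
    exact hst (hc.trans (zero_smul F _))
  -- Every entry into `E.bar t` factors through the pivot by some `g`; the second clause ensures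
  -- that `∑ D.proj s' ≫ g s'` restricts to `c` on the summand `s`.
  have hg : ∀ s', ∃ g : intervalModule F (D.bar s') ⟶ intervalModule F (D.bar s),
      entry D E Φ s' t = g ≫ intervalMap F h ∧
      D.incl s ≫ D.proj s' ≫ g = if s = s' then c • 𝟙 _ else 0 := by
    intro s'
    by_cases hs : s = s'
    · subst hs
      refine ⟨c • 𝟙 _, ?_, ?_⟩
      · rw [hc, Linear.smul_comp, Category.id_comp]
      · rw [if_pos rfl, reassoc_of% D.incl_proj s]
    · rw [if_neg hs]
      by_cases h0 : entry D E Φ s' t = 0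
      · exact ⟨0, by rw [h0, zero_comp], by simp⟩
      · have h' := overlaps_of_hom_ne_zero h0
        obtain ⟨d, hd⟩ := hom_eq_smul h' (entry D E Φ s' t)
        have ho : Overlaps (D.bar s) (D.bar s') :=
          ⟨(hrow s' h0).1, h'.2.1.trans h.2.2, (hrow s' h0).2⟩
        refine ⟨d • intervalMap F ho, ?_, ?_⟩
        · rw [Linear.smul_comp, intervalMap_comp ho h h', hd]
        · rw [reassoc_of% D.incl_proj_ne s s' hs, zero_comp]
  -- Dually, every entry out of `D.bar s` factors through the pivot.
  have hf : ∀ t', ∃ f : intervalModule F (E.bar t) ⟶ intervalModule F (E.bar t'),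
      entry D E Φ s t' = intervalMap F h ≫ f ∧
      f ≫ E.incl t' ≫ E.proj t = if t' = t then c • 𝟙 _ else 0 := by
    intro t'
    by_cases ht : t' = t
    · subst ht
      refine ⟨c • 𝟙 _, ?_, ?_⟩
      · rw [hc, Linear.comp_smul, Category.comp_id]
      · rw [if_pos rfl, E.incl_proj, Category.comp_id]
    · rw [if_neg ht]
      by_cases h0 : entry D E Φ s t' = 0
      · exact ⟨0, by rw [h0, comp_zero], by simp⟩
      · have h' := overlaps_of_hom_ne_zero h0
        obtain ⟨d, hd⟩ := hom_eq_smul h' (entry D E Φ s t')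
        have ho : Overlaps (E.bar t') (E.bar t) :=
          ⟨(hcol t' h0).1, h.1.trans h'.2.1, (hcol t' h0).2⟩
        refine ⟨d • intervalMap F ho, ?_, ?_⟩
        · rw [Linear.comp_smul, intervalMap_comp h ho h', hd]
        · rw [E.incl_proj_ne t' t ht, comp_zero]
  choose g hg hg' using hg
  choose f hf hf' using hf
  have hi : D.incl s ≫ Φ = intervalMap F h ≫ ∑ t', f t' ≫ E.incl t' := by
    rw [← sum_entry_incl D E, Preadditive.comp_sum]
    exact Finset.sum_congr rfl fun t' _ => by rw [hf, Category.assoc]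
  have hr : (∑ s', D.proj s' ≫ g s') ≫ intervalMap F h = Φ ≫ E.proj t := by
    rw [← sum_proj_entry D E, Preadditive.sum_comp]
    exact Finset.sum_congr rfl fun s' _ => by rw [hg, Category.assoc]
  refine ⟨h, Arrow.homMk (D.incl s) (∑ t', f t' ≫ E.incl t') hi,
    Arrow.homMk (c⁻¹ • ∑ s', D.proj s' ≫ g s') (c⁻¹ • E.proj t) ?_, ?_⟩
  · change (c⁻¹ • ∑ s', D.proj s' ≫ g s') ≫ intervalMap F h =
      Φ ≫ (c⁻¹ • E.proj t)
    rw [Linear.smul_comp, hr, Linear.comp_smul]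
  · refine Arrow.hom_ext _ _ ?_ ?_
    · change D.incl s ≫ (c⁻¹ • ∑ s', D.proj s' ≫ g s') = 𝟙 _
      rw [Linear.comp_smul, Preadditive.comp_sum, Finset.sum_congr rfl fun s' _ => hg' s',
        Finset.sum_ite_eq, if_pos (Finset.mem_univ _), inv_smul_smul₀ hc0]
    · change (∑ t', f t' ≫ E.incl t') ≫ (c⁻¹ • E.proj t) = 𝟙 _
      simp only [Linear.comp_smul, Preadditive.sum_comp, Category.assoc]
      rw [Finset.sum_congr rfl fun t' _ => hf' t', Finset.sum_ite_eq',
        if_pos (Finset.mem_univ _), inv_smul_smul₀ hc0]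

/-- A nonzero morphism with a `k`-inverse has a nonzero entry between bars whose endpoints differ by
at most `k`. -/
theorem exists_entry_ne_zero (D : BarBasis V ι) (E : BarBasis W κ) {Φ : V ⟶ W} (hΦ : Φ ≠ 0) {k : ℕ}
    {Ψ : W ⟶ shift k V} (h₁ : Φ ≫ Ψ = innerShift k V) (h₂ : Ψ ≫ shiftMap k Φ = innerShift k W) :
    ∃ s t, entry D E Φ s t ≠ 0 ∧ (D.bar s).fst.val ≤ (E.bar t).fst.val + k ∧
      (D.bar s).snd.val ≤ (E.bar t).snd.val + k := by
  by_contra! hne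
  -- A nonzero entry of `Ψ` would bound both endpoint differences by `k`, so no round trip `s → t →
  -- s` or `t → s → t` survives.
  have hzero : ∀ s t, entry D E Φ s t = 0 ∨ E.incl t ≫ Ψ ≫ shiftMap k (D.proj s) = 0 := by
    intro s t
    by_contra! h
    have := le_add_of_hom_shift_ne_zero h.2
    exact (hne s t h.1 this.1).not_ge this.2
  have hD : ∀ s, (D.bar s).snd.val < (D.bar s).fst.val + k := by
    refine fun s => not_le.1 fun h => innerShift_intervalModule_ne_zero (F := F) h ?_
    have : innerShift k (intervalModule F (D.bar s)) =
        (D.incl s ≫ Φ) ≫ Ψ ≫ shiftMap k (D.proj s) := by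
      rw [Category.assoc, reassoc_of% h₁, innerShift_naturality, reassoc_of% D.incl_proj s]
    rw [this, ← sum_entry_incl D E, Preadditive.sum_comp]
    refine Finset.sum_eq_zero fun t _ => ?_
    rcases hzero s t with h | h
    · rw [h, zero_comp, zero_comp]
    · rw [Category.assoc, h, comp_zero]
  have hE : ∀ t, (E.bar t).snd.val < (E.bar t).fst.val + k := by
    refine fun t => not_le.1 fun h => innerShift_intervalModule_ne_zero (F := F) h ?_
    have : innerShift k (intervalModule F (E.bar t)) =
        E.incl t ≫ Ψ ≫ shiftMap k (Φ ≫ E.proj t) := by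
      rw [shiftMap_comp, reassoc_of% h₂, innerShift_naturality, reassoc_of% E.incl_proj t]
    rw [this, ← sum_proj_entry D E, shiftMap_sum, Preadditive.comp_sum, Preadditive.comp_sum]
    refine Finset.sum_eq_zero fun s _ => ?_
    rw [shiftMap_comp]
    rcases hzero s t with h | h
    · rw [h, shiftMap_zero, comp_zero, comp_zero, comp_zero]
    · rw [← Category.assoc, ← Category.assoc, Category.assoc (E.incl t), h, zero_comp]
  -- Overlapping bars shorter than `k` have endpoints less than `k` apart, which `hne` excludes for
  -- nonzero entries.
  refine hΦ (eq_zero_of_entry_eq_zero D E Φ fun s t => by_contra fun h => ?_)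
  have ho := overlaps_of_hom_ne_zero h
  simp only [Overlaps, Fin.le_def] at ho
  have := hne s t h
  have := hD s
  have := hE t
  omega

/-- A set of bars in which the endpoints of strictly nested bars differ by more than `k`. -/
def NestedApart (k : ℕ) (B : Set (Bar l)) : Prop :=
  ∀ I ∈ B, ∀ J ∈ B, StrictlyNested I J →
    J.fst.val + k < I.fst.val ∧ I.snd.val + k < J.snd.val

/-- A nonzero morphism with a `k`-inverse between modules whose strictly nested bars are more than
`k` apart has a ladder `R_K^J` as a retract. -/
theorem exists_ladderR_retract (hV : IsPFD V) (hW : IsPFD W) {Φ : V ⟶ W} (hΦ : Φ ≠ 0) {k : ℕ}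
    {Ψ : W ⟶ shift k V} (h₁ : Φ ≫ Ψ = innerShift k V) (h₂ : Ψ ≫ shiftMap k Φ = innerShift k W)
    (hVk : NestedApart k (bars V)) (hWk : NestedApart k (bars W)) :
    ∃ (K J : Bar l) (h : Overlaps K J) (i : ladderR F K J h ⟶ Arrow.mk Φ)
      (r : Arrow.mk Φ ⟶ ladderR F K J h), i ≫ r = 𝟙 _ := by
  obtain ⟨n, D, hD⟩ := exists_barBasis V hV
  obtain ⟨m, E, hE⟩ := exists_barBasis W hW
  let good : Set (Fin n × Fin m) := {p | entry D E Φ p.1 p.2 ≠ 0 ∧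
    (D.bar p.1).fst.val ≤ (E.bar p.2).fst.val + k ∧ (D.bar p.1).snd.val ≤ (E.bar p.2).snd.val + k}
  -- The minimised quantity is the sum of the two endpoint differences; it is taken in `ℤ` to avoid
  -- truncated subtraction.
  obtain ⟨⟨s, t⟩, ⟨hst, hg₁, hg₂⟩, hmin⟩ := Set.exists_min_image good
    (fun p => ((D.bar p.1).fst.val + (D.bar p.1).snd.val : ℤ) -
      ((E.bar p.2).fst.val + (E.bar p.2).snd.val)) (Set.toFinite _)
    (let ⟨s, t, h⟩ := exists_entry_ne_zero D E hΦ h₁ h₂; ⟨(s, t), h⟩)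
  have ho := overlaps_of_hom_ne_zero hst
  simp only [Overlaps, Fin.le_def] at ho
  refine ⟨E.bar t, D.bar s, exists_retract_of_pivot D E Φ s t hst (fun s' hs' => ?_)
    fun t' ht' => ?_⟩
  -- Both bars dominate `E.bar t`, and `D.bar s` by at most `k`, so neither is strictly nested in
  -- the other. Were `D.bar s'` smaller in some endpoint, `(s', t)` would be good with a smaller
  -- sum. The column case is dual.
  · have ho' := overlaps_of_hom_ne_zero hs'
    have hn₁ := hVk _ (hD s) _ (hD s')
    have hn₂ := hVk _ (hD s') _ (hD s)
    have hm := fun h h' => hmin (s', t) ⟨hs', h, h'⟩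
    simp only [Overlaps, StrictlyNested, Fin.le_def, Fin.lt_def] at *
    have := (D.bar s).fst_le_snd
    have := (D.bar s').fst_le_snd
    simp only [Fin.le_def] at *
    omega
  · have ho' := overlaps_of_hom_ne_zero ht'
    have hn₁ := hWk _ (hE t) _ (hE t')
    have hn₂ := hWk _ (hE t') _ (hE t)
    have hm := fun h h' => hmin (s, t') ⟨ht', h, h'⟩
    simp only [Overlaps, StrictlyNested, Fin.le_def, Fin.lt_def] at *
    have := (E.bar t).fst_le_snd
    have := (E.bar t').fst_le_snd
    simp only [Fin.le_def] at *
    omega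

end Matrix

/-! ### Decomposition of ladder modules -/

theorem NestedApart.mono {k : ℕ} {B C : Set (Bar l)} (hC : NestedApart k C) (h : B ⊆ C) :
    NestedApart k B := fun I hI J hJ => hC I (h hI) J (h hJ)

/-- The minimum exceeds `k`, so both gaps do; strict nesting fixes the signs inside the absolute
values. -/
theorem nestedApart_of_lt_nestedness {V : PMod F l} {k : ℕ} (h : (k : ℕ∞) < nestedness V) :
    NestedApart k (bars V) := by
  intro I hI J hJ hIJ
  have h₁ : (k : ℕ∞) < ((min ((I.fst.val : ℤ) - J.fst.val).natAbs
      ((I.snd.val : ℤ) - J.snd.val).natAbs : ℕ) : ℕ∞) :=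
    h.trans_le (iInf_le_of_le I (iInf_le_of_le J (iInf_le_of_le hI (iInf_le_of_le hJ
      (iInf_le _ hIJ)))))
  rw [Nat.cast_lt, lt_min_iff] at h₁
  simp only [StrictlyNested, Fin.lt_def, Fin.le_def] at hIJ
  omega

theorem lt_nestedness_of_lt_half {k : ℕ} {δ : ℝ≥0} (hk : (k : ℝ≥0) = 2 * δ) {a b : ℕ∞}
    (h : (δ : ℝ≥0∞) < 1 / 2 * min (a : ℝ≥0∞) (b : ℝ≥0∞)) : (k : ℕ∞) < min a b := by
  have h₂ : (2 : ℝ≥0∞) * δ < min (a : ℝ≥0∞) (b : ℝ≥0∞) := by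
    rw [mul_comm]
    refine (ENNReal.lt_div_iff_mul_lt (Or.inl two_ne_zero) (Or.inl ENNReal.ofNat_ne_top)).1 ?_
    rwa [ENNReal.div_eq_inv_mul, ← one_div]
  have h₃ : (k : ℝ≥0∞) = 2 * δ := by
    exact_mod_cast congrArg ((↑) : ℝ≥0 → ℝ≥0∞) hk
  rw [← h₃, lt_min_iff] at h₂
  rw [lt_min_iff]
  exact ⟨by exact_mod_cast h₂.1, by exact_mod_cast h₂.2⟩

/-- Labels of the elementary ladder modules. -/
abbrev Label (l : ℕ) : Type := {p : Bar l × Bar l // Overlaps p.1 p.2} ⊕ Bar l ⊕ Bar l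

variable (F) in
/-- The elementary ladder module with a given label. -/
noncomputable def elementary : Label l → Ladder F l :=
  Sum.elim (fun p => ladderR F p.1.1 p.1.2 p.2) (Sum.elim (ladderIPlus F) (ladderIMinus F))

theorem biproduct_whiskerEquiv_naturality {ι κ : Type} [Finite ι] [Finite κ] (σ : ι ≃ κ)
    {f g : κ → PMod F l} (φ : ∀ j, f j ⟶ g j) :
    (biproduct.whiskerEquiv (f := fun i => f (σ i)) (g := f) σ fun _ => Iso.refl _).hom ≫
        biproduct.map φ =
      biproduct.map (fun i => φ (σ i)) ≫
        (biproduct.whiskerEquiv (f := fun i => g (σ i)) (g := g) σ fun _ => Iso.refl _).hom := by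
  refine biproduct.hom_ext' _ _ fun i => ?_
  simp [biproduct.whiskerEquiv]

/-- A reindexing of finite direct sums of ladder modules. -/
noncomputable def ladderSumIso {ι κ : Type} [Finite ι] [Finite κ] (σ : ι ≃ κ) (M : κ → Ladder F l) :
    ladderSum (fun i => M (σ i)) ≅ ladderSum M :=
  Arrow.isoMk
    (biproduct.whiskerEquiv (f := fun i => (M (σ i)).left) (g := fun j => (M j).left) σ
      fun _ => Iso.refl _)
    (biproduct.whiskerEquiv (f := fun i => (M (σ i)).right) (g := fun j => (M j).right) σ
      fun _ => Iso.refl _)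
    (biproduct_whiskerEquiv_naturality σ fun j => (M j).hom)

/-- A finite direct sum of elementary ladder modules, sorted by isomorphism type. -/
theorem exists_iso_elementarySum {ι : Type} [Finite ι] (lab : ι → Label l) :
    ∃ (r : {p : Bar l × Bar l // Overlaps p.1 p.2} → ℕ) (dPlus dMinus : Bar l → ℕ),
      Nonempty (ladderSum (fun i => elementary F (lab i)) ≅ elementarySum F r dPlus dMinus) := by
  have e : ∀ x, {i // lab i = x} ≃ Fin (Nat.card {i // lab i = x}) := fun x => Finite.equivFin _
  let n : Label l → ℕ := fun x => Nat.card {i // lab i = x}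
  -- Indices are grouped into fibres of `lab`; multiplicities are the fibre cardinalities.
  let σ : ι ≃ (Σ p, Fin (n (Sum.inl p))) ⊕ (Σ J, Fin (n (Sum.inr (Sum.inl J)))) ⊕
      (Σ K, Fin (n (Sum.inr (Sum.inr K)))) :=
    (Equiv.sigmaFiberEquiv lab).symm.trans <| (Equiv.sigmaCongrRight e).trans <|
      (Equiv.sumSigmaDistrib fun x => Fin (n x)).trans <|
        Equiv.sumCongr (Equiv.refl _) (Equiv.sumSigmaDistrib fun x => Fin (n (Sum.inr x)))
  refine ⟨fun p => n (Sum.inl p), fun J => n (Sum.inr (Sum.inl J)),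
    fun K => n (Sum.inr (Sum.inr K)), ⟨(eqToIso (congrArg ladderSum
      (funext fun y => ?_)) ≪≫ ladderSumIso σ.symm fun i => elementary F (lab i)).symm⟩⟩
  rcases y with ⟨p, y⟩ | ⟨J, y⟩ | ⟨K, y⟩
  · exact congrArg (elementary F) ((e (Sum.inl p)).symm y).2.symm
  · exact congrArg (elementary F) ((e (Sum.inr (Sum.inl J))).symm y).2.symm
  · exact congrArg (elementary F) ((e (Sum.inr (Sum.inr K))).symm y).2.symm

theorem exists_nontrivial_intervalModule (J : Bar l) :
    ∃ t, Nontrivial ((intervalModule F J).obj t) :=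
  ⟨J.fst, nontrivial_intervalModule ⟨le_rfl, J.fst_le_snd⟩⟩

/-- Ensures that splitting off an elementary ladder lowers the total dimension. -/
theorem elementary_nontrivial (x : Label l) : (∃ t, Nontrivial ((elementary F x).left.obj t)) ∨
    ∃ t, Nontrivial ((elementary F x).right.obj t) := by
  rcases x with p | J | K
  · exact Or.inl (exists_nontrivial_intervalModule p.1.2)
  · exact Or.inl (exists_nontrivial_intervalModule J)
  · exact Or.inr (exists_nontrivial_intervalModule K)

theorem bars_subset_of_decomposition_left {x : Label l} {V B : PMod F l}
    (D : Decomposition V (elementary F x).left B) : bars B ⊆ bars V := by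
  rcases x with p | J | K
  · exact bars_subset_of_decomposition (J := p.1.2) D
  · exact bars_subset_of_decomposition (J := J) D
  · exact bars_subset_of_isZero (isZero_zero _) D

theorem bars_subset_of_decomposition_right {x : Label l} {V B : PMod F l}
    (D : Decomposition V (elementary F x).right B) : bars B ⊆ bars V := by
  rcases x with p | J | K
  · exact bars_subset_of_decomposition (J := p.1.1) D
  · exact bars_subset_of_isZero (isZero_zero _) D
  · exact bars_subset_of_decomposition (J := K) D

/-- A nonzero ladder module whose morphism has a `k`-inverse, with strictly nested bars more
than `k` apart, has an elementary ladder module as a retract. -/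
theorem exists_elementary_retract {V W : PMod F l} (hV : IsPFD V) (hW : IsPFD W) {Φ : V ⟶ W} {k : ℕ}
    {Ψ : W ⟶ shift k V} (h₁ : Φ ≫ Ψ = innerShift k V) (h₂ : Ψ ≫ shiftMap k Φ = innerShift k W)
    (hVk : NestedApart k (bars V)) (hWk : NestedApart k (bars W))
    (h : (∃ t, Nontrivial (V.obj t)) ∨ ∃ t, Nontrivial (W.obj t)) :
    ∃ (x : Label l) (i : elementary F x ⟶ Arrow.mk Φ) (r : Arrow.mk Φ ⟶ elementary F x),
      i ≫ r = 𝟙 _ := by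
  by_cases hΦ : Φ = 0
  · subst hΦ
    rcases h with h | h
    · obtain ⟨J, i, r, hir⟩ := exists_interval_retract _ h
      refine ⟨Sum.inr (Sum.inl J), Arrow.homMk (f := ladderIPlus F J) i 0 ?_,
        Arrow.homMk (g := ladderIPlus F J) r 0 ?_, Arrow.hom_ext _ _ hir ?_⟩
      · exact comp_zero.trans zero_comp.symm
      · exact comp_zero.trans zero_comp.symm
      · exact (isZero_zero _).eq_of_src _ _
    · obtain ⟨K, i, r, hir⟩ := exists_interval_retract _ h
      refine ⟨Sum.inr (Sum.inr K), Arrow.homMk (f := ladderIMinus F K) 0 i ?_,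
        Arrow.homMk (g := ladderIMinus F K) 0 r ?_, Arrow.hom_ext _ _ ?_ hir⟩
      · exact comp_zero.trans zero_comp.symm
      · exact comp_zero.trans zero_comp.symm
      · exact (isZero_zero _).eq_of_src _ _
  · obtain ⟨K, J, ho, i, r, hir⟩ := exists_ladderR_retract hV hW hΦ h₁ h₂ hVk hWk
    exact ⟨Sum.inl ⟨(K, J), ho⟩, i, r, hir⟩

/-- A morphism with a `k`-inverse between modules whose strictly nested bars are more than `k` apart
is a finite direct sum of elementary ladder modules. -/
theorem exists_iso_ladderSum {V W : PMod F l} (hV : IsPFD V) (hW : IsPFD W) {δ : ℝ≥0} {k : ℕ}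
    (hk : (k : ℝ≥0) = 2 * δ) {Φ : V ⟶ W} (hΦ : IsDeltaInvertible δ Φ)
    (hVk : NestedApart k (bars V)) (hWk : NestedApart k (bars W)) :
    ∃ (n : ℕ) (lab : Fin n → Label l),
      Nonempty (Arrow.mk Φ ≅ ladderSum fun i => elementary F (lab i)) := by
  induction hn : totalDim V + totalDim W using Nat.strong_induction_on generalizing V W with
  | _ n ih =>
    by_cases h : (∃ t, Nontrivial (V.obj t)) ∨ ∃ t, Nontrivial (W.obj t)
    · obtain ⟨k', hk', Ψ, h₁, h₂⟩ := id hΦ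
      -- The integer shift is determined by `δ`, so it matches the `k` of the nestedness bounds.
      obtain rfl : k' = k := by exact_mod_cast hk'.trans hk.symm
      obtain ⟨x, i, r, hir⟩ := exists_elementary_retract hV hW h₁ h₂ hVk hWk h
      obtain ⟨V', W', Φ', D, E, hfst, hsnd, hinr⟩ := exists_decomposition_of_retract i r hir
      have hlt : totalDim V' + totalDim W' < n := by
        rw [← hn]
        rcases elementary_nontrivial (F := F) x with ⟨t, ht⟩ | ⟨t, ht⟩
        · exact add_lt_add_of_lt_of_le (totalDim_lt hV D ht) (totalDim_le hW E)
        · exact add_lt_add_of_le_of_lt (totalDim_le hV D) (totalDim_lt hW E ht)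
      obtain ⟨m, lab, ⟨e⟩⟩ := ih _ hlt (hV.of_decomposition D) (hW.of_decomposition E)
        (hΦ.of_retract D.inr_snd E.inr_snd hinr hsnd)
        (hVk.mono (bars_subset_of_decomposition_left D))
        (hWk.mono (bars_subset_of_decomposition_right E)) rfl
      let L : Option (Fin m) → Ladder F l := fun o => elementary F (o.elim x lab)
      exact ⟨m + 1, fun j => (finSuccEquiv m j).elim x lab,
        ⟨arrowIsoOption (L := L) D E hfst hsnd e ≪≫ (ladderSumIso (finSuccEquiv m) L).symm⟩⟩
    · rw [not_or] at h
      have hz : ∀ f : Fin 0 → PMod F l, IsZero (⨁ f) := fun f =>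
        (IsZero.iff_id_eq_zero _).2 (biproduct.hom_ext _ _ fun j => j.elim0)
      refine ⟨0, Fin.elim0, ⟨Arrow.isoMk
        ((isZero_of_forall_not_nontrivial h.1).iso (hz _))
        ((isZero_of_forall_not_nontrivial h.2).iso (hz _))
        ((isZero_of_forall_not_nontrivial h.1).eq_of_src _ _)⟩⟩

end Persistence

open Persistence in
theorem mainTheorem1 {F : Type u} [Field F] {l : ℕ} (V W : PMod F l)
    (hV : IsPFD V) (hW : IsPFD W) (δ : ℝ≥0) (Φ : V ⟶ W) (hΦ : IsDeltaInvertible δ Φ)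
    (hδ : (δ : ℝ≥0∞) < 1 / 2 * min (nestedness V : ℝ≥0∞) (nestedness W : ℝ≥0∞)) :
    ∃ (r : {p : Bar l × Bar l // Overlaps p.1 p.2} → ℕ) (dPlus dMinus : Bar l → ℕ),
      Nonempty (Arrow.mk Φ ≅ elementarySum F r dPlus dMinus) := by
  obtain ⟨k, hk, -⟩ := id hΦ
  have hlt := lt_min_iff.1 (lt_nestedness_of_lt_half hk hδ)
  obtain ⟨n, lab, ⟨e⟩⟩ := exists_iso_ladderSum hV hW hk hΦ (nestedApart_of_lt_nestedness hlt.1)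
    (nestedApart_of_lt_nestedness hlt.2)
  obtain ⟨r, dPlus, dMinus, ⟨e'⟩⟩ := exists_iso_elementarySum (F := F) lab
  exact ⟨r, dPlus, dMinus, ⟨e ≪≫ e'⟩⟩
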